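/- Let $n\ge 1$, let $\mathbb{G}_n$ be the Clifford (geometric) algebra of the Euclidean space $\mathbb{E}_n$, with $\mathbf{v}\mathbf{v}=\mathbf{v}\cdot\mathbf{v}$ for every vector $\mathbf{v}\in\mathbb{E}_n\subseteq\mathbb{G}_n$, and for vectors put $$\mathbf{u}_1\wedge\cdots\wedge\mathbf{u}_k=\frac1{k!}\sum_{\sigma\in\mathcal S_k}\operatorname{sgn}(\sigma)\,\mathbf{u}_{\sigma_1}\cdots\mathbf{u}_{\sigma_k}\in\mathbb{G}_n$$ (equal to $1$ if $k=0$). Let $\mathbf{a}_1,\dots,\mathbf{a}_{n+1}\in\mathbb{E}_n$ be the vertices of a non-degenerate simplex, that is, $\Delta=(\mathbf{a}_2-\mathbf{a}_1)\wedge\cdots\wedge(\mathbf{a}_{n+1}-\mathbf{a}_1)\neq0$. For $1\le i\le n-1$ let $\overline{\mathbf{a}_i}$ be the mirror image (orthogonal reflection) of $\mathbf{a}_i$ in the affine subspace through $\mathbf{a}_{i+1},\dots,\mathbf{a}_{n+1}$. Let $f:\mathbb{E}_n\to\mathbb{R}$ be any function (only its values at the points $\mathbf{a}_i$ and $\overline{\mathbf{a}_i}$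 matter). Put $$\overline{\Delta}=\bigwedge_{j=1}^{n-1}(\overline{\mathbf{a}_j}-\mathbf{a}_j),\qquad \overline{\Delta^i}=\Big(\bigwedge_{1\le j\le n-1,\ j\ne i}(\overline{\mathbf{a}_j}-\mathbf{a}_j)\Big)\wedge(\mathbf{a}_{n+1}-\mathbf{a}_n)\quad(1\le i\le n-1),$$ $$\overline{\Delta}f=\frac1{2^{n-1}}\Big\{\sum_{i=1}^{n-1}(-1)^{i+1}\big[f(\overline{\mathbf{a}_i})-f(\mathbf{a}_i)\big]\,\overline{\Delta^i}+(-1)^{n+1}\big[f(\mathbf{a}_{n+1})-f(\mathbf{a}_n)\big]\,\overline{\Delta}\Big\}.$$ Then the vectors $\overline{\mathbf{a}_1}-\mathbf{a}_1,\dots,\overline{\mathbf{a}_{n-1}}-\mathbf{a}_{n-1},\ \mathbf{a}_{n+1}-\mathbf{a}_n$ are mutually orthogonal, these vectors and $\Delta$ are invertible in $\mathbb{G}_n$, and the mean multi-difference Clifford quotient $\overline{\mathbf{r}}_f=\big(\overline{\Delta}f\big)\,\Delta^{-1}$ is the vector $$\overline{\mathbf{r}}_f=\sum_{i=1}^{n-1}\frac{f(\overline{\mathbf{a}_i})-f(\mathbf{a}_i)}{\overline{\mathbf{a}_i}-\mathbf{a}_i}+\frac{f(\mathbf{a}_{n+1})-f(\mathbf{a}_n)}{\mathbf{a}_{n+1}-\mathbf{a}_n},$$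 where, for $\alpha\in\mathbb{R}$ and a nonzero vector $\mathbf{v}$, $\dfrac{\alpha}{\mathbf{v}}=\alpha\,\mathbf{v}^{-1}=\dfrac{\alpha}{|\mathbf{v}|^2}\,\mathbf{v}$. -/

import Mathlib

namespace MeanSecant

noncomputable section

/-- The Euclidean space of dimension `n`. -/
abbrev E (n : ℕ) : Type := EuclideanSpace ℝ (Fin n)

/-- The quadratic form `v ↦ v · v` of the Euclidean space. -/
def Q (n : ℕ) : QuadraticForm ℝ (E n) :=
  LinearMap.BilinMap.toQuadraticMap (innerₗ (E n))

/-- The geometric algebra `𝔾ₙ`: the Clifford algebra of Euclidean space, with `v v = v · v`. -/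
abbrev G (n : ℕ) : Type := CliffordAlgebra (Q n)

/-- The inclusion of the vectors in the geometric algebra. -/
abbrev vec {n : ℕ} (v : E n) : G n := CliffordAlgebra.ι (Q n) v

/-- The outer product of vectors inside the geometric algebra,
`u₁ ∧ ⋯ ∧ uₖ = (1 / k!) ∑ σ, sign σ • u_{σ 1} ⋯ u_{σ k}` (equal to `1` if `k = 0`). -/
def wedge {n k : ℕ} (u : Fin k → E n) : G n :=
  (1 / (k.factorial : ℝ)) •
    ∑ σ : Equiv.Perm (Fin k),
      Equiv.Perm.sign σ • (List.ofFn fun j : Fin k => vec (u (σ j))).prod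

/-- The quotient `α / v = α v⁻¹` of a scalar by an (invertible) vector in the geometric algebra. -/
def scalarDiv {n : ℕ} (α : ℝ) (v : E n) : G n := α • Ring.inverse (vec v)

/-! From here on the dimension is `n = m + 1`, the `n + 1` points `a₁, …, aₙ₊₁` are
`a 0, …, a (m + 1)`, and the indices `1, …, n - 1` are the elements of `Fin m`. -/

/-- The pseudo-scalar `Δ = (a₂ - a₁) ∧ ⋯ ∧ (aₙ₊₁ - a₁)`. -/
def simplexBlade {m : ℕ} (a : Fin (m + 2) → E (m + 1)) : G (m + 1) :=
  wedge fun j : Fin (m + 1) => a j.succ - a 0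

/-- The affine subspace through the points `aᵢ₊₁, …, aₙ₊₁` (for `1 ≤ i ≤ n - 1`). -/
def mirror {m : ℕ} (a : Fin (m + 2) → E (m + 1)) (i : Fin m) :
    AffineSubspace ℝ (E (m + 1)) :=
  affineSpan ℝ (a '' Set.Ioi i.castSucc.castSucc)

theorem mirror_nonempty {m : ℕ} (a : Fin (m + 2) → E (m + 1)) (i : Fin m) :
    Nonempty (mirror a i) :=
  ⟨⟨a (Fin.last (m + 1)), subset_affineSpan ℝ _
    ⟨Fin.last (m + 1), Fin.castSucc_lt_last i.castSucc, rfl⟩⟩⟩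

/-- The mirrored point `āᵢ`: the orthogonal reflection of `aᵢ` in the affine subspace through
`aᵢ₊₁, …, aₙ₊₁`. -/
def mirrored {m : ℕ} (a : Fin (m + 2) → E (m + 1)) (i : Fin m) : E (m + 1) :=
  haveI := mirror_nonempty a i
  EuclideanGeometry.reflection (mirror a i) (a i.castSucc.castSucc)

/-- The `n` vectors `ā₁ - a₁, …, āₙ₋₁ - aₙ₋₁, aₙ₊₁ - aₙ`, in this order. -/
def diagonals {m : ℕ} (a : Fin (m + 2) → E (m + 1)) : Fin (m + 1) → E (m + 1) :=
  Fin.snoc (α := fun _ => E (m + 1))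
    (fun i : Fin m => mirrored a i - a i.castSucc.castSucc)
    (a (Fin.last m).succ - a (Fin.last m).castSucc)

/-- `Δ̄ = (ā₁ - a₁) ∧ ⋯ ∧ (āₙ₋₁ - aₙ₋₁)`. -/
def meanBlade {m : ℕ} (a : Fin (m + 2) → E (m + 1)) : G (m + 1) :=
  wedge fun j : Fin m => diagonals a j.castSucc

/-- `Δ̄ⁱ`: the outer product of all `āⱼ - aⱼ` with `j ≠ i`, followed by `aₙ₊₁ - aₙ`. -/
def meanBladeOmit {m : ℕ} (a : Fin (m + 2) → E (m + 1)) (i : Fin m) : G (m + 1) :=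
  wedge fun j : Fin m => diagonals a (i.castSucc.succAbove j)

/-- The mean multi-difference pseudo-vector
`Δ̄f = 2^{-(n-1)} { ∑ᵢ (-1)^{i+1} [f(āᵢ) - f(aᵢ)] Δ̄ⁱ + (-1)^{n+1} [f(aₙ₊₁) - f(aₙ)] Δ̄ }`,
where the index `i` of the formula is `i + 1` for `i : Fin m`, and `n = m + 1`. -/
def meanMultiDiff {m : ℕ} (f : E (m + 1) → ℝ) (a : Fin (m + 2) → E (m + 1)) : G (m + 1) :=
  (1 / (2 : ℝ) ^ m) •
    ((∑ i : Fin m, ((-1 : ℝ) ^ ((i : ℕ) + 1 + 1) *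
          (f (mirrored a i) - f (a i.castSucc.castSucc))) • meanBladeOmit a i)
      + ((-1 : ℝ) ^ (m + 1 + 1) *
          (f (a (Fin.last m).succ) - f (a (Fin.last m).castSucc))) • meanBlade a)

/-- The mean multi-difference Clifford quotient `r̄ = (Δ̄f) Δ⁻¹`. -/
def meanQuotient {m : ℕ} (f : E (m + 1) → ℝ) (a : Fin (m + 2) → E (m + 1)) : G (m + 1) :=
  meanMultiDiff f a * Ring.inverse (simplexBlade a)

end

end MeanSecant

/-! Let `d` be the family `diagonals a`. Each reflected difference is twice the vector from the
vertex to its foot in the mirror, hence orthogonal to the mirror's direction, while all later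
members of `d` lie in that direction: `d` is orthogonal. The foot differs from the next vertex by a
combination of later edges, so `d` is triangular over the edges with diagonal `2, …, 2, 1`, and its
outer product is `2 ^ m` times the simplex blade (`wedge_diagonals`). Orthogonal vectors
anticommute, so their outer product is their geometric product (`wedge_eq_geomProd`). Deleting `d i`
then amounts, up to sign, to left multiplication by its inverse (`smul_wedge_succAbove`). Hence the
multi-difference is the claimed vector times the blade, and the blade cancels. -/

/-- An alternating map evaluated at the linear combinations with coefficient matrix `M` of a family
is the determinant of `M` times its value at the family. -/
theorem AlternatingMap.map_sum_smul_eq_det_smul {R V N ι : Type*} [CommRing R] [AddCommGroup V]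
    [Module R V] [AddCommGroup N] [Module R N] [Fintype ι] [DecidableEq ι]
    (g : V [⋀^ι]→ₗ[R] N) (M : Matrix ι ι R) (v : ι → V) :
    g (fun i => ∑ j, M i j • v j) = M.det • g v := by
  -- Both sides are alternating in the rows of the matrix, so injective selections of standard basis
  -- vectors suffice.
  have key : g.compLinearMap (Fintype.linearCombination R v) =
      (LinearMap.toSpanSingleton R N (g v)).compAlternatingMap (Pi.basisFun R ι).det := by
    refine Module.Basis.ext_alternating (Pi.basisFun R ι) fun i hi => ?_
    let σ : Equiv.Perm ι := Equiv.ofBijective i (Finite.injective_iff_bijective.1 hi)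
    have h1 : (fun j => Fintype.linearCombination R v (Pi.basisFun R ι (i j))) = v ∘ σ := by
      ext j
      simp [Fintype.linearCombination_apply_single, σ]
    have h2 : (fun j => Pi.basisFun R ι (i j)) = (Pi.basisFun R ι) ∘ σ := rfl
    simp only [AlternatingMap.compLinearMap_apply, LinearMap.compAlternatingMap_apply]
    rw [h1, h2, AlternatingMap.map_perm, AlternatingMap.map_perm, Module.Basis.det_self]
    rcases Int.units_eq_one_or (Equiv.Perm.sign σ) with h | h <;> simp [h]
  have := congrArg (fun φ => φ M.row) key
  simp only [AlternatingMap.compLinearMap_apply, Fintype.linearCombination_apply,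
    LinearMap.compAlternatingMap_apply, Pi.basisFun_det_apply] at this
  exact this

/-- The value of an alternating map at a family that is triangular with respect to another one. -/
theorem AlternatingMap.map_of_sub_smul_mem_span_Ioi {R V N ι : Type*} [CommRing R]
    [AddCommGroup V] [Module R V] [AddCommGroup N] [Module R N] [Fintype ι] [LinearOrder ι]
    (g : V [⋀^ι]→ₗ[R] N) (c : ι → R) (v w : ι → V)
    (h : ∀ i, w i - c i • v i ∈ Submodule.span R (v '' Set.Ioi i)) :
    g w = (∏ i, c i) • g v := by
  have h' : ∀ i, ∃ l : ι →₀ R, l ∈ Finsupp.supported R R (Set.Ioi i) ∧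
      Finsupp.linearCombination R v l = w i - c i • v i := fun i =>
    (Finsupp.mem_span_image_iff_linearCombination R).1 (h i)
  choose l hl hlw using h'
  have hl0 : ∀ i j, j ≤ i → l i j = 0 := fun i j hij => by
    by_contra hne
    exact absurd ((Finsupp.mem_supported R _).1 (hl i) (Finsupp.mem_support_iff.2 hne))
      (by simpa using hij)
  -- `l i` is supported strictly above `i`, so `M` is upper triangular with diagonal `c`.
  let M : Matrix ι ι R := fun i j => l i j + if j = i then c i else 0
  have hw : w = fun i => ∑ j, M i j • v j := by
    funext i
    have := hlw i
    rw [Finsupp.linearCombination_apply, Finsupp.sum_fintype _ _ (by simp)] at this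
    simp [M, add_smul, Finset.sum_add_distrib, this, ite_smul]
  have hM : M.BlockTriangular id := fun i j hij => by
    have hij : j < i := hij
    simp [M, hl0 i j hij.le, hij.ne]
  rw [hw, AlternatingMap.map_sum_smul_eq_det_smul, Matrix.det_of_isUpperTriangular hM]
  simp [M, hl0]

namespace MeanSecant

variable {n k m : ℕ}

/-! ### Vectors and their inverses in the Clifford algebra -/

theorem Q_apply (v : E n) : Q n v = ‖v‖ ^ 2 := by
  simp [Q, LinearMap.BilinMap.toQuadraticMap_apply]

theorem isOrtho_Q {u v : E n} (h : inner ℝ u v = (0 : ℝ)) : (Q n).IsOrtho u v := by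
  rw [QuadraticMap.isOrtho_def, Q_apply, Q_apply, Q_apply, @norm_add_sq ℝ, RCLike.re_to_real, h]
  ring

theorem isUnit_vec {v : E n} (h : v ≠ 0) : IsUnit (vec v) :=
  CliffordAlgebra.isUnit_ι_of_isUnit _ (by simp [Q_apply, h])

theorem inverse_vec {v : E n} (h : v ≠ 0) :
    Ring.inverse (vec v) = (1 / ‖v‖ ^ 2) • vec v := by
  have hn : ‖v‖ ^ 2 ≠ 0 := by simp [h]
  refine (isUnit_vec h).mul_left_cancel ?_
  rw [Ring.mul_inverse_cancel _ (isUnit_vec h), mul_smul_comm, CliffordAlgebra.ι_sq_scalar, Q_apply,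
    Algebra.smul_def, ← map_mul, one_div_mul_cancel hn, map_one]

theorem scalarDiv_eq {α : ℝ} {v : E n} (h : v ≠ 0) :
    scalarDiv α v = vec ((α / ‖v‖ ^ 2) • v) := by
  rw [scalarDiv, inverse_vec h, smul_smul, mul_one_div]
  exact (map_smul _ _ _).symm

/-! ### Products of mutually orthogonal vectors -/

/-- The geometric product of a family of vectors, in order. -/
noncomputable def geomProd (u : Fin k → E n) : G n := (List.ofFn fun j => vec (u j)).prod

theorem geomProd_succ (u : Fin (k + 1) → E n) :
    geomProd u = vec (u 0) * geomProd fun j => u j.succ := by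
  simp [geomProd, List.ofFn_succ]

theorem isUnit_geomProd {u : Fin k → E n} (h : ∀ i, u i ≠ 0) : IsUnit (geomProd u) := by
  induction k with
  | zero => simp [geomProd]
  | succ k ih =>
    rw [geomProd_succ]
    exact (isUnit_vec (h 0)).mul (ih fun i => h i.succ)

/-- Orthogonal vectors anticommute. Peeling off leading factors brings the adjacent pair to the
front. -/
theorem geomProd_swap {u : Fin (k + 1) → E n}
    (h : Pairwise fun i j => inner ℝ (u i) (u j) = (0 : ℝ)) (i : Fin k) :
    geomProd (fun j => u (Equiv.swap i.castSucc i.succ j)) = -geomProd u := by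
  induction k with
  | zero => exact i.elim0
  | succ k ih =>
    induction i using Fin.cases with
    | zero =>
      have h3 : ∀ j : Fin k, Equiv.swap (0 : Fin (k + 2)) 1 j.succ.succ = j.succ.succ := fun j =>
        Equiv.swap_apply_of_ne_of_ne (Fin.succ_ne_zero _)
          (by rw [← Fin.succ_zero_eq_one]; exact fun e => Fin.succ_ne_zero _ (Fin.succ_injective _ e))
      simp only [geomProd_succ, Fin.castSucc_zero, Fin.succ_zero_eq_one, Equiv.swap_apply_left,
        Equiv.swap_apply_right, h3]
      exact CliffordAlgebra.ι_mul_ι_mul_of_isOrtho _ (isOrtho_Q (h Fin.zero_ne_one.symm))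
    | succ i =>
      have h0 : Equiv.swap i.succ.castSucc i.succ.succ 0 = 0 :=
        Equiv.swap_apply_of_ne_of_ne (by simp [Fin.ext_iff]) (Fin.succ_ne_zero _).symm
      have h1 : ∀ j : Fin (k + 1), Equiv.swap i.succ.castSucc i.succ.succ j.succ =
          (Equiv.swap i.castSucc i.succ j).succ := fun j => by
        rw [← Fin.succ_castSucc, (Fin.succ_injective _).swap_apply]
      rw [geomProd_succ, geomProd_succ u]
      simp only [h0, h1]
      rw [ih (u := fun j => u j.succ) (fun a b hab => h ((Fin.succ_injective _).ne hab)), mul_neg]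

/-- Adjacent transpositions generate the symmetric group, and reindexing preserves orthogonality. -/
theorem geomProd_perm {u : Fin k → E n}
    (h : Pairwise fun i j => inner ℝ (u i) (u j) = (0 : ℝ)) (σ : Equiv.Perm (Fin k)) :
    geomProd (fun j => u (σ j)) = Equiv.Perm.sign σ • geomProd u := by
  cases k with
  | zero => simp [geomProd, Subsingleton.elim σ 1]
  | succ k =>
    induction σ using Submonoid.induction_of_closure_eq_top_right
      (Equiv.Perm.mclosure_swap_castSucc_succ k) with
    | one => simp
    | mul_right σ τ hτ ih =>
      obtain ⟨i, rfl⟩ := hτ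
      have := geomProd_swap (u := fun j => u (σ j)) (fun a b hab => h (σ.injective.ne hab)) i
      simp only [Equiv.Perm.mul_apply]
      rw [this, ih, Equiv.Perm.sign_mul,
        Equiv.Perm.sign_swap (Fin.castSucc_lt_succ).ne, mul_neg_one, Units.neg_smul]

/-- The outer product of mutually orthogonal vectors is their geometric product. -/
theorem wedge_eq_geomProd {u : Fin k → E n}
    (h : Pairwise fun i j => inner ℝ (u i) (u j) = (0 : ℝ)) : wedge u = geomProd u := by
  -- Each reordering sign cancels the sign in the definition, so all `k!` summands agree.
  have key : ∀ σ : Equiv.Perm (Fin k), Equiv.Perm.sign σ •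
      (List.ofFn fun j : Fin k => vec (u (σ j))).prod = geomProd u := fun σ => by
    have := geomProd_perm h σ
    rw [geomProd] at this
    rw [this, smul_smul, Int.units_mul_self, one_smul]
  rw [wedge, Finset.sum_congr rfl fun σ _ => key σ, Finset.sum_const, Finset.card_univ,
    Fintype.card_perm, Fintype.card_fin, ← Nat.cast_smul_eq_nsmul ℝ, smul_smul,
    one_div_mul_cancel (by positivity), one_smul]

/-- Removing one factor from a geometric product of mutually orthogonal vectors. -/
theorem geomProd_eq_smul_vec_mul {u : Fin (k + 1) → E n}
    (h : Pairwise fun i j => inner ℝ (u i) (u j) = (0 : ℝ)) (i : Fin (k + 1)) :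
    geomProd u = (-1 : ℝ) ^ (i : ℕ) • (vec (u i) * geomProd fun j => u (i.succAbove j)) := by
  -- This cycle brings factor `i` to the front, keeps the others in order, and has sign `(-1) ^ i`.
  have := geomProd_perm h i.cycleRange.symm
  rw [geomProd_succ] at this
  simp only [Fin.cycleRange_symm_zero, Fin.cycleRange_symm_succ] at this
  rw [this, Equiv.Perm.sign_symm, Fin.sign_cycleRange]
  rcases Nat.even_or_odd (i : ℕ) with hi | hi <;> simp [hi.neg_one_pow, Units.smul_def]

/-- The outer product as an alternating map. -/
noncomputable def wedgeAlternating (n k : ℕ) : E n [⋀^Fin k]→ₗ[ℝ] G n :=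
  (1 / (k.factorial : ℝ)) • MultilinearMap.alternatization
    ((MultilinearMap.mkPiAlgebraFin ℝ k (G n)).compLinearMap fun _ => CliffordAlgebra.ι (Q n))

theorem wedgeAlternating_apply (u : Fin k → E n) : wedgeAlternating n k u = wedge u := by
  simp [wedgeAlternating, wedge, MultilinearMap.alternatization_apply]

/-! ### The simplex blade in terms of edges -/

/-- The edges `a₂ - a₁, …, aₙ₊₁ - aₙ`. -/
noncomputable def edges (a : Fin (m + 2) → E (m + 1)) (i : Fin (m + 1)) : E (m + 1) :=
  a i.succ - a i.castSucc

/-- The vectors from the first vertex are partial sums of edges: the matrix is lower unitriangular,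
with determinant 1. -/
theorem simplexBlade_eq_wedge_edges (a : Fin (m + 2) → E (m + 1)) :
    simplexBlade a = wedge (edges a) := by
  let M : Matrix (Fin (m + 1)) (Fin (m + 1)) ℝ := fun i j => if j ≤ i then 1 else 0
  have hM : M.BlockTriangular OrderDual.toDual := fun i j hij => by
    have hij : i < j := hij
    simp [M, hij]
  have hsum : ∀ i : Fin (m + 1), a i.succ - a 0 = ∑ j, (if j ≤ i then (1 : ℝ) else 0) • edges a j := fun i => by
    induction i using Fin.induction with
    | zero => simp [edges]
    | succ i ih =>
      have : ∀ j, (if j ≤ i.succ then (1 : ℝ) else 0) • edges a j =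
          (if j ≤ i.castSucc then (1 : ℝ) else 0) • edges a j + if j = i.succ then edges a j else 0 := fun j => by
        rcases lt_trichotomy j i.succ with h | rfl | h
        · simp [h.le, h.ne, Fin.le_castSucc_iff.2 h]
        · simp
        · have h' : ¬ j ≤ i.castSucc := not_le.2 (lt_trans Fin.castSucc_lt_succ h)
          simp [not_le.2 h, h', h.ne']
      rw [Finset.sum_congr rfl fun j _ => this j, Finset.sum_add_distrib, ← ih]
      simp [edges]
  have key := AlternatingMap.map_sum_smul_eq_det_smul (wedgeAlternating (m + 1) (m + 1)) M (edges a)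
  rw [Matrix.det_of_isLowerTriangular M hM] at key
  rw [simplexBlade, ← wedgeAlternating_apply, ← wedgeAlternating_apply, funext hsum]
  simpa [M] using key

/-! ### Mirrors, reflections and orthogonality -/

variable (a : Fin (m + 2) → E (m + 1))

theorem mem_mirror {i : Fin m} {j : Fin (m + 2)} (h : i.castSucc.castSucc < j) :
    a j ∈ mirror a i :=
  subset_affineSpan ℝ _ ⟨j, h, rfl⟩

theorem mirror_antitone : Antitone (mirror a) := fun i j h =>
  affineSpan_mono ℝ (Set.image_mono (Set.Ioi_subset_Ioi (by simpa using h)))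

/-- With the first vertex of the mirror as base point, differences of vertices telescope into later
edges. -/
theorem direction_mirror_le (i : Fin m) :
    (mirror a i).direction ≤ Submodule.span ℝ (edges a '' Set.Ioi i.castSucc) := by
  have key : ∀ j : Fin (m + 2), i.castSucc.succ ≤ j →
      a j - a i.castSucc.succ ∈ Submodule.span ℝ (edges a '' Set.Ioi i.castSucc) := fun j => by
    induction j using Fin.induction with
    | zero => exact fun h => absurd h (by simp)
    | succ j ih =>
      intro h
      rcases h.eq_or_lt with h | h
      · simp [h]
      · have h1 : i.castSucc < j := Fin.succ_lt_succ_iff.1 h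
        have h2 := Submodule.add_mem _ (Submodule.subset_span (Set.mem_image_of_mem (edges a) h1))
          (ih (Fin.le_def.2 (by simpa [Fin.lt_def, Nat.succ_le_iff] using h1)))
        simpa [edges] using h2
  have hmem : a i.castSucc.succ ∈ a '' Set.Ioi i.castSucc.castSucc :=
    ⟨_, Fin.castSucc_lt_succ, rfl⟩
  rw [mirror, direction_affineSpan, vectorSpan_eq_span_vsub_set_right ℝ hmem, Submodule.span_le]
  rintro _ ⟨_, ⟨j, hj, rfl⟩, rfl⟩
  exact key j (Fin.castSucc_lt_iff_succ_le.1 hj)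

/-- The mirrored point differs from the original one by twice the vector to its projection. -/
theorem exists_mirrored_sub_eq (i : Fin m) : ∃ p ∈ mirror a i,
    mirrored a i - a i.castSucc.castSucc = (2 : ℝ) • (p - a i.castSucc.castSucc) ∧
      mirrored a i - a i.castSucc.castSucc ∈ (mirror a i).directionᗮ := by
  have := mirror_nonempty a i
  have h : mirrored a i - a i.castSucc.castSucc = (2 : ℝ) •
      ((EuclideanGeometry.orthogonalProjection (mirror a i) (a i.castSucc.castSucc) : E (m + 1)) -
        a i.castSucc.castSucc) := by
    rw [mirrored, EuclideanGeometry.reflection_apply']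
    simp only [vsub_eq_sub, vadd_eq_add, two_smul]
    abel
  refine ⟨_, EuclideanGeometry.orthogonalProjection_mem (s := mirror a i) (a i.castSucc.castSucc),
    h, ?_⟩
  rw [h]
  exact Submodule.smul_mem _ _
    (EuclideanGeometry.orthogonalProjection_vsub_mem_direction_orthogonal _ _)

@[simp] theorem diagonals_castSucc (i : Fin m) :
    diagonals a i.castSucc = mirrored a i - a i.castSucc.castSucc := by
  simp [diagonals]

@[simp] theorem diagonals_last :
    diagonals a (Fin.last m) = a (Fin.last m).succ - a (Fin.last m).castSucc := by
  simp [diagonals]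

/-- The mirrors are nested, so for `j` after `i` both the vertex `a j` and its foot lie in mirror
`i`. -/
theorem diagonals_mem_direction {i : Fin m} {j : Fin (m + 1)} (h : i.castSucc < j) :
    diagonals a j ∈ (mirror a i).direction := by
  induction j using Fin.lastCases with
  | last =>
    rw [diagonals_last]
    exact AffineSubspace.vsub_mem_direction
      (mem_mirror a (Fin.castSucc_lt_castSucc_iff.2 h |>.trans Fin.castSucc_lt_succ))
      (mem_mirror a (Fin.castSucc_lt_castSucc_iff.2 h))
  | cast j =>
    obtain ⟨p, hp, hd, -⟩ := exists_mirrored_sub_eq a j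
    rw [diagonals_castSucc, hd]
    exact Submodule.smul_mem _ _ (AffineSubspace.vsub_mem_direction
      (mirror_antitone a (Fin.castSucc_lt_castSucc_iff.1 h).le hp)
      (mem_mirror a (Fin.castSucc_lt_castSucc_iff.2 h)))

theorem diagonals_orthogonal :
    Pairwise fun i j => inner ℝ (diagonals a i) (diagonals a j) = (0 : ℝ) := by
  have key : ∀ i j, i < j → inner ℝ (diagonals a i) (diagonals a j) = (0 : ℝ) := fun i j h => by
    induction i using Fin.lastCases with
    | last => exact absurd h (Fin.le_last j).not_gt
    | cast i =>
      obtain ⟨-, -, -, ho⟩ := exists_mirrored_sub_eq a i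
      rw [diagonals_castSucc]
      exact Submodule.inner_left_of_mem_orthogonal (diagonals_mem_direction a h) ho
  intro i j hij
  rcases hij.lt_or_gt with h | h
  · exact key i j h
  · rw [real_inner_comm]
    exact key j i h

/-! ### The blade as an orthogonal product, and the quotient -/

theorem wedge_diagonals : wedge (diagonals a) = (2 : ℝ) ^ m • simplexBlade a := by
  rw [simplexBlade_eq_wedge_edges, ← wedgeAlternating_apply, ← wedgeAlternating_apply,
    AlternatingMap.map_of_sub_smul_mem_span_Ioi _
      (Fin.snoc (α := fun _ => ℝ) (fun _ : Fin m => 2) 1) (edges a), Fin.prod_univ_castSucc]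
  · simp
  · intro i
    induction i using Fin.lastCases with
    | last => simp [edges]
    | cast i =>
      obtain ⟨p, hp, hd, -⟩ := exists_mirrored_sub_eq a i
      -- Replacing the vertex by the next one leaves a vector between two points of the mirror.
      have h : diagonals a i.castSucc - (2 : ℝ) • edges a i.castSucc =
          (2 : ℝ) • (p - a i.castSucc.succ) := by
        rw [diagonals_castSucc, hd, edges, ← smul_sub, sub_sub_sub_cancel_right]
      rw [Fin.snoc_castSucc, h]
      exact Submodule.smul_mem _ _ (direction_mirror_le a i (AffineSubspace.vsub_mem_direction hp
        (mem_mirror a Fin.castSucc_lt_succ)))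

theorem simplexBlade_eq_smul_geomProd :
    simplexBlade a = (1 / (2 : ℝ) ^ m) • geomProd (diagonals a) := by
  rw [← wedge_eq_geomProd (diagonals_orthogonal a), wedge_diagonals, smul_smul,
    one_div_mul_cancel (by positivity), one_smul]

variable {a}

/-- A zero entry would make the outer product vanish, but it is a nonzero multiple of the blade. -/
theorem diagonals_ne_zero (ha : simplexBlade a ≠ 0) (i : Fin (m + 1)) : diagonals a i ≠ 0 := by
  intro h
  have := (wedgeAlternating _ _).map_coord_zero (m := diagonals a) i h
  rw [wedgeAlternating_apply, wedge_diagonals] at this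
  exact ha ((smul_eq_zero.1 this).resolve_left (by positivity))

theorem isUnit_simplexBlade (ha : simplexBlade a ≠ 0) : IsUnit (simplexBlade a) := by
  rw [simplexBlade_eq_smul_geomProd]
  exact (isUnit_geomProd (diagonals_ne_zero ha)).smul (Units.mk0 (1 / (2 : ℝ) ^ m) (by positivity))

/-- Omitting one of the orthogonal vectors is dividing the pseudo-scalar by it. -/
theorem smul_wedge_succAbove (ha : simplexBlade a ≠ 0) (i : Fin (m + 1)) :
    (1 / (2 : ℝ) ^ m) • (-1 : ℝ) ^ (i : ℕ) • wedge (fun j => diagonals a (i.succAbove j)) =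
      Ring.inverse (vec (diagonals a i)) * simplexBlade a := by
  have ho := diagonals_orthogonal a
  rw [simplexBlade_eq_smul_geomProd, geomProd_eq_smul_vec_mul ho i, mul_smul_comm, mul_smul_comm,
    Ring.inverse_mul_cancel_left _ _ (isUnit_vec (diagonals_ne_zero ha i)),
    wedge_eq_geomProd fun j l h => ho (Fin.succAbove_right_injective.ne h)]

theorem meanQuotient_eq (ha : simplexBlade a ≠ 0) (f : E (m + 1) → ℝ) :
    meanQuotient f a =
      (∑ i : Fin m, scalarDiv (f (mirrored a i) - f (a i.castSucc.castSucc))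
          (mirrored a i - a i.castSucc.castSucc))
      + scalarDiv (f (a (Fin.last m).succ) - f (a (Fin.last m).castSucc))
          (a (Fin.last m).succ - a (Fin.last m).castSucc) := by
  have h1 : ∀ i : Fin m, (1 / (2 : ℝ) ^ m) • ((-1 : ℝ) ^ ((i : ℕ) + 1 + 1) *
      (f (mirrored a i) - f (a i.castSucc.castSucc))) • meanBladeOmit a i =
      scalarDiv (f (mirrored a i) - f (a i.castSucc.castSucc))
          (mirrored a i - a i.castSucc.castSucc) * simplexBlade a := fun i => by
    rw [scalarDiv, smul_mul_assoc, ← diagonals_castSucc, ← smul_wedge_succAbove ha, meanBladeOmit,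
      Fin.val_castSucc]
    -- The exponent `i + 1 + 1` comes from 1-based numbering and has the parity of `i`.
    simp only [smul_smul, pow_succ]
    congr 1
    ring
  have h2 : (1 / (2 : ℝ) ^ m) • ((-1 : ℝ) ^ (m + 1 + 1) *
      (f (a (Fin.last m).succ) - f (a (Fin.last m).castSucc))) • meanBlade a =
      scalarDiv (f (a (Fin.last m).succ) - f (a (Fin.last m).castSucc))
          (a (Fin.last m).succ - a (Fin.last m).castSucc) * simplexBlade a := by
    rw [scalarDiv, smul_mul_assoc, ← diagonals_last, ← smul_wedge_succAbove ha, meanBlade,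
      Fin.val_last]
    simp only [smul_smul, pow_succ, Fin.succAbove_last]
    congr 1
    ring
  rw [meanQuotient, meanMultiDiff, smul_add, Finset.smul_sum, h2,
    Finset.sum_congr rfl fun i _ => h1 i, ← Finset.sum_mul, ← add_mul,
    Ring.mul_inverse_cancel_right _ _ (isUnit_simplexBlade ha)]

end MeanSecant

theorem mainTheorem2 (m : ℕ) (a : Fin (m + 2) → MeanSecant.E (m + 1))
    (ha : MeanSecant.simplexBlade a ≠ 0) (f : MeanSecant.E (m + 1) → ℝ) :
    -- the vectors `āᵢ - aᵢ` and `aₙ₊₁ - aₙ` are mutually orthogonal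
    ((∀ i j : Fin m, i ≠ j →
        inner ℝ (MeanSecant.mirrored a i - a i.castSucc.castSucc)
          (MeanSecant.mirrored a j - a j.castSucc.castSucc) = 0) ∧
      (∀ i : Fin m,
        inner ℝ (MeanSecant.mirrored a i - a i.castSucc.castSucc)
          (a (Fin.last m).succ - a (Fin.last m).castSucc) = 0)) ∧
    -- all the divisors are invertible in the geometric algebra
    (IsUnit (MeanSecant.simplexBlade a) ∧
      (∀ i : Fin m,
        IsUnit (MeanSecant.vec (MeanSecant.mirrored a i - a i.castSucc.castSucc))) ∧
      IsUnit (MeanSecant.vec (a (Fin.last m).succ - a (Fin.last m).castSucc))) ∧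
    -- the formula, with `α / v = α v⁻¹` in the geometric algebra
    MeanSecant.meanQuotient f a =
      (∑ i : Fin m,
        MeanSecant.scalarDiv (f (MeanSecant.mirrored a i) - f (a i.castSucc.castSucc))
          (MeanSecant.mirrored a i - a i.castSucc.castSucc))
      + MeanSecant.scalarDiv (f (a (Fin.last m).succ) - f (a (Fin.last m).castSucc))
          (a (Fin.last m).succ - a (Fin.last m).castSucc) ∧
    -- the same formula, with `α / v` written as the vector `(α / |v|²) v`
    MeanSecant.meanQuotient f a =
      MeanSecant.vec
        ((∑ i : Fin m,
          ((f (MeanSecant.mirrored a i) - f (a i.castSucc.castSucc)) /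
            ‖MeanSecant.mirrored a i - a i.castSucc.castSucc‖ ^ 2) •
              (MeanSecant.mirrored a i - a i.castSucc.castSucc))
        + ((f (a (Fin.last m).succ) - f (a (Fin.last m).castSucc)) /
            ‖a (Fin.last m).succ - a (Fin.last m).castSucc‖ ^ 2) •
              (a (Fin.last m).succ - a (Fin.last m).castSucc)) := by
  have hne := MeanSecant.diagonals_ne_zero ha
  have ho := MeanSecant.diagonals_orthogonal a
  have hi : ∀ i : Fin m, MeanSecant.mirrored a i - a i.castSucc.castSucc ≠ 0 := fun i => by
    simpa only [MeanSecant.diagonals_castSucc] using hne i.castSucc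
  have hl : a (Fin.last m).succ - a (Fin.last m).castSucc ≠ 0 := by
    simpa only [MeanSecant.diagonals_last] using hne (Fin.last m)
  have hq := MeanSecant.meanQuotient_eq ha f
  refine ⟨⟨fun i j hij => ?_, fun i => ?_⟩, ⟨MeanSecant.isUnit_simplexBlade ha,
    fun i => MeanSecant.isUnit_vec (hi i), MeanSecant.isUnit_vec hl⟩, hq, ?_⟩
  · simpa only [MeanSecant.diagonals_castSucc] using ho ((Fin.castSucc_injective m).ne hij)
  · simpa only [MeanSecant.diagonals_castSucc, MeanSecant.diagonals_last] using
      ho (Fin.castSucc_lt_last i).ne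
  · rw [hq, MeanSecant.scalarDiv_eq hl,
      Finset.sum_congr rfl fun i _ => MeanSecant.scalarDiv_eq (hi i)]
    simp only [map_add, map_sum]
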